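/- Let $n\in\mathbb N$, let $\mathbb C^+=\{w\in\mathbb C:\operatorname{Im}w>0\}$, and let $\mathscr S_n(\mathbb C^+)$ be the set of analytic functions $B:\mathbb C^+\to\mathbb C^{n\times n}$ with $\|B(w)\|\le 1$ (Euclidean operator norm) for all $w$. If $B\in\mathscr S_n(\mathbb C^+)$ and $\alpha$ is a unitary $n\times n$ matrix such that $I-B(w)\alpha^*$ is invertible for all $w\in\mathbb C^+$, the Clark measure $\mu^{B\alpha^*}$ is the unique finite nonnegative matrix-valued Borel measure on $\mathbb R$ for which there is a positive semidefinite matrix $c$ with $$\operatorname{Re}\big[(I-B(w)\alpha^*)^{-1}(I+B(w)\alpha^*)\big]=c\,\operatorname{Im}w+\int_{\mathbb R}\frac{(1+t^2)\operatorname{Im}w}{|t-w|^2}\,\mu^{B\alpha^*}(dt),\qquad w\in\mathbb C^+,$$ where $\operatorname{Re}A=\tfrac12(A+A^*)$. Let $\frac{d\mu^{B\alpha^*}}{dm}$ denote the Lebesgue weight of its absolutely continuous part, i.e. its entrywise Radon–Nikodym derivative with respect to Lebesgue measure $m$ on $\mathbb R$. **Theorem.** Let $B_1,B_2\in\mathscr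 S_n(\mathbb C^+)$ and let $R,Q$ be constant unitary $n\times n$ matrices with $B_1(w)=R\,B_2(w)\,Q$ for all $w\in\mathbb C^+$. Let $\alpha$ be a unitary $n\times n$ matrix such that $I-B_1(w)\alpha^*$ is invertible for all $w\in\mathbb C^+$ (equivalently, $I-B_2(w)Q\alpha^*R$ is). Then $$\frac{d\mu^{B_1\alpha^*}}{dm}(s)=R\,\frac{d\mu^{B_2(Q\alpha^*R)}}{dm}(s)\,R^*\qquad\text{for Lebesgue-a.e. }s\in\mathbb R.$$ -/

import Mathlib

open MeasureTheory
open scoped Matrix ComplexOrder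

noncomputable section

/-- The closed unit ball `[H^∞(X) ⊗ ℂ^{n×n}]₁` of contractive analytic `n × n` matrix-valued
functions on `X`; functions on `X` are represented by their extensions to `ℂ`, whose values
outside `X` are irrelevant. The norm of a matrix is its operator norm on Euclidean `ℂⁿ`. -/
def schurClass (n : ℕ) (X : Set ℂ) : Set (ℂ → Matrix (Fin n) (Fin n) ℂ) :=
  {B | (∀ i j, DifferentiableOn ℂ (fun w => B w i j) X) ∧
    ∀ w ∈ X, ‖Matrix.toEuclideanCLM (𝕜 := ℂ) (B w)‖ ≤ 1}

/-- The open upper half-plane. -/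
def upperHalf : Set ℂ := {w | 0 < w.im}

/-- The Herglotz function `(I - C(w))⁻¹ (I + C(w))` of a matrix-valued function `C`. -/
def herglotz {n : ℕ} (C : ℂ → Matrix (Fin n) (Fin n) ℂ) (w : ℂ) : Matrix (Fin n) (Fin n) ℂ :=
  (1 - C w)⁻¹ * (1 + C w)

/-- The real part `(A + A*) / 2` of a matrix. -/
def hermitianPart {n : ℕ} (A : Matrix (Fin n) (Fin n) ℂ) : Matrix (Fin n) (Fin n) ℂ :=
  (2 : ℂ)⁻¹ • (A + Aᴴ)

/-- The `(j, k)` entry of a matrix-valued measure on the line, as a complex measure. -/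
def measureEntry {n : ℕ} (μ : VectorMeasure ℝ (Matrix (Fin n) (Fin n) ℂ)) (j k : Fin n) :
    ComplexMeasure ℝ :=
  μ.mapRange (Matrix.entryAddMonoidHom ℂ j k) (continuous_id.matrix_elem j k)

/-- The Poisson kernel of the disk transported to the upper half-plane by the Cayley transform
`γ(w) = (w - i) / (w + i)`: `(1 - |γ(w)|²) / |1 - γ(w) conj(γ(t))|² = Im w (1 + t²) / |t - w|²`. -/
def cayleyPoissonKernel (w : ℂ) (t : ℝ) : ℝ :=
  w.im * (1 + t ^ 2) / ‖(t : ℂ) - w‖ ^ 2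

/-- `μ` is the nonnegative matrix-valued measure on `ℝ` in the Herglotz representation
`Re H(w) = c Im w + ∫ Im w (1 + t²) / |t - w|² μ(dt)` on the upper half-plane, where
`H = (I - C)⁻¹ (I + C)`. In terms of the disk, `μ` is the pullback under the Cayley transform of
the Clark measure of `C ∘ γ⁻¹` on the circle, and `c` is the mass of the latter at `γ(∞) = 1`. -/
def IsClarkMeasure {n : ℕ} (C : ℂ → Matrix (Fin n) (Fin n) ℂ)
    (μ : VectorMeasure ℝ (Matrix (Fin n) (Fin n) ℂ)) : Prop :=
  (∀ E : Set ℝ, MeasurableSet E → (μ E).PosSemidef) ∧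
  ∃ c : Matrix (Fin n) (Fin n) ℂ, c.PosSemidef ∧
    ∀ w ∈ upperHalf, ∀ j k : Fin n,
      hermitianPart (herglotz C w) j k =
        (w.im : ℂ) * c j k +
          (measureEntry μ j k).integral (cayleyPoissonKernel w) (ContinuousLinearMap.lsmul ℝ ℝ)

open scoped Classical in
/-- The Clark measure of a contractive analytic `C` on the upper half-plane with `I - C(w)`
invertible: the unique measure with `IsClarkMeasure C`. -/
def clarkMeasure {n : ℕ} (C : ℂ → Matrix (Fin n) (Fin n) ℂ) :
    VectorMeasure ℝ (Matrix (Fin n) (Fin n) ℂ) :=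
  if h : ∃ μ, IsClarkMeasure C μ then h.choose else 0

/-- The Lebesgue weight `dμ/dm` of the absolutely continuous part of a matrix-valued measure `μ`:
the matrix of Radon-Nikodym derivatives of its entries with respect to Lebesgue measure. -/
def lebesgueWeight {n : ℕ} (μ : VectorMeasure ℝ (Matrix (Fin n) (Fin n) ℂ)) (s : ℝ) :
    Matrix (Fin n) (Fin n) ℂ :=
  Matrix.of fun j k => (measureEntry μ j k).rnDeriv volume s

end

/-!
Conjugating `C` by a unitary matrix `R` conjugates its Herglotz function, hence turns a Clark
representation of `C` with measure `μ` into one of `R C R*` with measure `R μ R*`. The measure of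
a Clark representation is determined by `C`: for finite measures this is Stieltjes inversion,
since as `y ↓ 0` the densities `x ↦ ∫ K_{x + iy}(t) p(dt)` converge vaguely to `π (1 + t²) p(dt)`
while the linear term `c y` vanishes; the Jordan decomposition gives the signed case and real
functionals the vector-valued one. So the Clark measure of `R C R*` is `R μ R*`, and
Radon–Nikodym derivatives are linear. The theorem is the case `C = B₂ Q α* R`, for which
`R C R* = B₁ α*`.
-/

open Filter Topology

section VectorMeasure

variable {X : Type*} {mX : MeasurableSpace X}
  {E F F' G G' : Type*} [NormedAddCommGroup E] [NormedSpace ℝ E]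
  [NormedAddCommGroup F] [NormedSpace ℝ F] [NormedAddCommGroup F'] [NormedSpace ℝ F']
  [NormedAddCommGroup G] [NormedSpace ℝ G] [NormedAddCommGroup G'] [NormedSpace ℝ G']

theorem variation_mapRange_le (μ : VectorMeasure X F) (T : F →L[ℝ] F') :
    (μ.mapRange (T : F →+ F') T.continuous).variation ≤ (‖T‖₊ : ENNReal) • μ.variation :=
  VectorMeasure.variation_le_of_forall_enorm_le fun s _ =>
    (T.le_opENorm (μ s)).trans (mul_le_mul_right (μ.enorm_measure_le_variation s) _)

theorem integral_mapRange_eq_integral_comp (μ : VectorMeasure X F) (T : F →L[ℝ] F')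
    (B : E →L[ℝ] F' →L[ℝ] G) {f : X → E} (hf : μ.Integrable f) :
    ∫ᵛ x, f x ∂[B; μ.mapRange (T : F →+ F') T.continuous] =
      ∫ᵛ x, f x ∂[(B.flip.comp T).flip; μ] :=
  (setToFun_congr_measure_of_integrable _ ENNReal.coe_ne_top (variation_mapRange_le μ T)
    (dominatedFinMeasAdditive_cbmApplyMeasure μ (B.flip.comp T).flip) _ f hf).symm

theorem integral_postcomp [CompleteSpace G] [CompleteSpace G'] (μ : VectorMeasure X F)
    (B : E →L[ℝ] F →L[ℝ] G) (T : G →L[ℝ] G') {f : X → E} (hf : μ.Integrable f) :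
    ∫ᵛ x, f x ∂[(ContinuousLinearMap.compL ℝ F G G' T).comp B; μ] = T (∫ᵛ x, f x ∂[B; μ]) := by
  refine Integrable.induction
    (fun g => ∫ᵛ x, g x ∂[(ContinuousLinearMap.compL ℝ F G G' T).comp B; μ] =
      T (∫ᵛ x, g x ∂[B; μ]))
    (fun c s hs hμs => ?indicator) (fun g₁ g₂ _ hg₁ hg₂ ih₁ ih₂ => ?add) ?closed
    (fun g₁ g₂ hg _ ih => ?congr_ae) hf
  case indicator =>
    rw [VectorMeasure.integral_eq_setToFun, VectorMeasure.integral_eq_setToFun,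
      setToFun_indicator_const _ hs hμs.ne, setToFun_indicator_const _ hs hμs.ne]
    rfl
  case add =>
    simp only [Pi.add_apply]
    rw [VectorMeasure.integral_fun_add hg₁ hg₂, VectorMeasure.integral_fun_add hg₁ hg₂, map_add,
      ih₁, ih₂]
  case closed =>
    exact isClosed_eq (continuous_setToFun _) (T.continuous.comp (continuous_setToFun _))
  case congr_ae =>
    rwa [← VectorMeasure.integral_congr_ae hg, ← VectorMeasure.integral_congr_ae hg]

theorem integral_mapRange [CompleteSpace F] [CompleteSpace F'] (μ : VectorMeasure X F)
    (T : F →L[ℝ] F') {f : X → ℝ} (hf : μ.Integrable f) :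
    ∫ᵛ x, f x ∂•(μ.mapRange (T : F →+ F') T.continuous) = T (∫ᵛ x, f x ∂•μ) := by
  rw [integral_mapRange_eq_integral_comp μ T _ hf, ← integral_postcomp μ _ T hf]
  congr 1
  ext y
  exact (T.map_smul (1 : ℝ) y).symm

theorem isFiniteMeasure_variation_signedMeasure (s : SignedMeasure X) :
    IsFiniteMeasure s.variation := by
  rw [← SignedMeasure.totalVariation_eq_variation, SignedMeasure.totalVariation]
  infer_instance

theorem isFiniteMeasure_variation [FiniteDimensional ℝ F] (μ : VectorMeasure X F) :
    IsFiniteMeasure μ.variation := by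
  let b := Module.finBasis ℝ F
  let coord i : SignedMeasure X :=
    μ.mapRange (b.coord i).toAddMonoidHom (b.coord i).continuous_of_finiteDimensional
  have hle : μ.variation ≤ ∑ i, (‖b i‖₊ : ENNReal) • (coord i).variation := by
    refine VectorMeasure.variation_le_of_forall_enorm_le fun s _ => ?_
    calc ‖μ s‖ₑ = ‖∑ i, coord i s • b i‖ₑ := congrArg _ (b.sum_repr (μ s)).symm
      _ ≤ ∑ i, ‖coord i s • b i‖ₑ := enorm_sum_le _ _
      _ = ∑ i, ‖b i‖ₑ * ‖coord i s‖ₑ := by simp only [enorm_smul, mul_comm]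
      _ ≤ ∑ i, ‖b i‖ₑ * (coord i).variation s := by
        gcongr with i
        exact VectorMeasure.enorm_measure_le_variation _ s
      _ = (∑ i, (‖b i‖₊ : ENNReal) • (coord i).variation) s := by
        rw [Measure.finsetSum_apply]; rfl
  have := fun i => isFiniteMeasure_variation_signedMeasure (coord i)
  have := fun i => (coord i).variation.smul_finite (c := ‖b i‖₊) ENNReal.coe_ne_top
  exact isFiniteMeasure_of_le _ hle

theorem signedMeasure_integral_eq_sub (s : SignedMeasure X) {f : X → G}
    (hp : Integrable f s.toJordanDecomposition.posPart)
    (hn : Integrable f s.toJordanDecomposition.negPart) :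
    ∫ᵛ x, f x ∂<•s =
      ∫ x, f x ∂s.toJordanDecomposition.posPart - ∫ x, f x ∂s.toJordanDecomposition.negPart := by
  conv_lhs => rw [← s.toSignedMeasure_toJordanDecomposition, JordanDecomposition.toSignedMeasure]
  rw [VectorMeasure.integral_sub_vectorMeasure
    (by simpa [VectorMeasure.Integrable] using hp) (by simpa [VectorMeasure.Integrable] using hn),
    VectorMeasure.integral_toSignedMeasure, VectorMeasure.integral_toSignedMeasure]

end VectorMeasure

section HalfPlanePoisson

/-- The Poisson kernel of the upper half-plane at height `y`, as a function of the horizontal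
displacement `s`, without the normalising factor `1 / π`. -/
noncomputable def halfPlanePoisson (y s : ℝ) : ℝ :=
  y / (s ^ 2 + y ^ 2)

theorem halfPlanePoisson_nonneg {y : ℝ} (hy : 0 ≤ y) (s : ℝ) : 0 ≤ halfPlanePoisson y s := by
  unfold halfPlanePoisson
  positivity

theorem sq_mul_halfPlanePoisson_le {y : ℝ} (hy : 0 < y) (s : ℝ) :
    s ^ 2 * halfPlanePoisson y s ≤ y := by
  rw [halfPlanePoisson, mul_div_left_comm]
  exact mul_le_of_le_one_right hy.le
    (div_le_one_of_le₀ (le_add_of_nonneg_right (sq_nonneg y)) (by positivity))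

theorem halfPlanePoisson_le_inv {y : ℝ} (hy : 0 < y) (s : ℝ) : halfPlanePoisson y s ≤ y⁻¹ := by
  have hden : y ^ 2 ≤ s ^ 2 + y ^ 2 := le_add_of_nonneg_left (sq_nonneg s)
  calc halfPlanePoisson y s ≤ y / y ^ 2 := by unfold halfPlanePoisson; gcongr
    _ = y⁻¹ := by field_simp

theorem continuous_halfPlanePoisson {y : ℝ} (hy : 0 < y) : Continuous (halfPlanePoisson y) :=
  Continuous.div (by fun_prop) (by fun_prop) fun s => by positivity

variable {E : Type*} [NormedAddCommGroup E] [NormedSpace ℝ E]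

theorem integral_halfPlanePoisson_smul_eq (f : ℝ → E) {y : ℝ} (hy : 0 < y) (t : ℝ) :
    ∫ x, halfPlanePoisson y (x - t) • f x = ∫ s, (1 + s ^ 2)⁻¹ • f (t + y * s) := by
  have hscale (s : ℝ) : y * halfPlanePoisson y (y * s) = (1 + s ^ 2)⁻¹ := by
    rw [halfPlanePoisson]; field_simp; ring
  calc ∫ x, halfPlanePoisson y (x - t) • f x
      = ∫ x, halfPlanePoisson y x • f (t + x) := by
        rw [← integral_add_left_eq_self _ t]
        simp only [add_sub_cancel_left]
    _ = y • ∫ s, halfPlanePoisson y (y * s) • f (t + y * s) := by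
        rw [Measure.integral_comp_mul_left (fun x => halfPlanePoisson y x • f (t + x)) y,
          abs_of_pos (inv_pos.2 hy), smul_inv_smul₀ hy.ne']
    _ = ∫ s, (1 + s ^ 2)⁻¹ • f (t + y * s) := by
        simp only [← integral_smul, smul_smul, hscale]

theorem norm_inv_one_add_sq_smul_le {f : ℝ → E} {A : ℝ} (hA : ∀ x, ‖f x‖ ≤ A) (s x : ℝ) :
    ‖(1 + s ^ 2)⁻¹ • f x‖ ≤ (1 + s ^ 2)⁻¹ * A := by
  rw [norm_smul, Real.norm_of_nonneg (by positivity)]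
  gcongr
  exact hA x

theorem tendsto_integral_halfPlanePoisson_smul [CompleteSpace E] {f : ℝ → E}
    (hf : Continuous f) {A : ℝ} (hA : ∀ x, ‖f x‖ ≤ A) (t : ℝ) :
    Tendsto (fun y => ∫ x, halfPlanePoisson y (x - t) • f x) (𝓝[>] 0) (𝓝 (Real.pi • f t)) := by
  have h : Tendsto (fun y => ∫ s, (1 + s ^ 2)⁻¹ • f (t + y * s)) (𝓝[>] 0)
      (𝓝 (∫ s : ℝ, (1 + s ^ 2)⁻¹ • f t)) := by
    refine tendsto_integral_filter_of_dominated_convergence (fun s => (1 + s ^ 2)⁻¹ * A)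
      (.of_forall fun y => ?_)
      (.of_forall fun y => .of_forall fun s => norm_inv_one_add_sq_smul_le hA s _)
      (integrable_inv_one_add_sq.mul_const A) (.of_forall fun s => ?_)
    · refine (Continuous.smul (.inv₀ (by fun_prop) fun s => ?_) (by fun_prop)).aestronglyMeasurable
      positivity
    · have hcont : Continuous fun y => f (t + y * s) := by fun_prop
      refine Tendsto.const_smul (tendsto_nhdsWithin_of_tendsto_nhds ?_) _
      simpa only [zero_mul, add_zero] using hcont.tendsto 0
  rw [integral_smul_const, integral_univ_inv_one_add_sq] at h
  refine h.congr' ?_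
  filter_upwards [self_mem_nhdsWithin] with y hy
  exact (integral_halfPlanePoisson_smul_eq f hy t).symm

theorem norm_integral_halfPlanePoisson_smul_le {f : ℝ → E} {A : ℝ} (hA : ∀ x, ‖f x‖ ≤ A)
    {y : ℝ} (hy : 0 < y) (t : ℝ) :
    ‖∫ x, halfPlanePoisson y (x - t) • f x‖ ≤ Real.pi * A := by
  rw [integral_halfPlanePoisson_smul_eq f hy, ← integral_univ_inv_one_add_sq,
    ← integral_mul_const]
  exact norm_integral_le_of_norm_le (integrable_inv_one_add_sq.mul_const A)
    (.of_forall fun s => norm_inv_one_add_sq_smul_le hA s _)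

end HalfPlanePoisson

section CayleyPoissonKernel

theorem cayleyPoissonKernel_eq (w : ℂ) (t : ℝ) :
    cayleyPoissonKernel w t = (1 + t ^ 2) * halfPlanePoisson w.im (w.re - t) := by
  have hnorm : ‖(t : ℂ) - w‖ ^ 2 = (w.re - t) ^ 2 + w.im ^ 2 := by
    rw [Complex.sq_norm, Complex.normSq_apply]
    simp only [Complex.sub_re, Complex.ofReal_re, Complex.sub_im, Complex.ofReal_im]
    ring
  rw [cayleyPoissonKernel, hnorm, halfPlanePoisson]
  ring

theorem cayleyPoissonKernel_nonneg {w : ℂ} (hw : w ∈ upperHalf) (t : ℝ) :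
    0 ≤ cayleyPoissonKernel w t := by
  rw [cayleyPoissonKernel_eq]
  exact mul_nonneg (by positivity) (halfPlanePoisson_nonneg (le_of_lt hw) _)

theorem cayleyPoissonKernel_le {w : ℂ} (hw : w ∈ upperHalf) (t : ℝ) :
    cayleyPoissonKernel w t ≤
      (1 + 2 * w.re ^ 2) * halfPlanePoisson w.im (w.re - t) + 2 * w.im := by
  have hP := halfPlanePoisson_nonneg (le_of_lt hw) (w.re - t)
  -- With `x = w.re`, the growth of the kernel in `t` is controlled by `t² ≤ 2 x² + 2 (x - t)²`.
  calc cayleyPoissonKernel w t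
      ≤ ((1 + 2 * w.re ^ 2) + 2 * (w.re - t) ^ 2) * halfPlanePoisson w.im (w.re - t) := by
        rw [cayleyPoissonKernel_eq]
        refine mul_le_mul_of_nonneg_right ?_ hP
        linarith [sq_nonneg (2 * w.re - t)]
    _ = (1 + 2 * w.re ^ 2) * halfPlanePoisson w.im (w.re - t) +
          2 * ((w.re - t) ^ 2 * halfPlanePoisson w.im (w.re - t)) := by ring
    _ ≤ _ := by gcongr; exact sq_mul_halfPlanePoisson_le hw _

theorem norm_cayleyPoissonKernel_le {w : ℂ} (hw : w ∈ upperHalf) (t : ℝ) :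
    ‖cayleyPoissonKernel w t‖ ≤ (1 + 2 * w.re ^ 2) * w.im⁻¹ + 2 * w.im := by
  rw [Real.norm_of_nonneg (cayleyPoissonKernel_nonneg hw t)]
  refine (cayleyPoissonKernel_le hw t).trans ?_
  gcongr
  exact halfPlanePoisson_le_inv hw _

theorem continuous_cayleyPoissonKernel {y : ℝ} (hy : 0 < y) :
    Continuous fun z : ℝ × ℝ => cayleyPoissonKernel ⟨z.1, y⟩ z.2 := by
  have hP := continuous_halfPlanePoisson hy
  simp only [cayleyPoissonKernel_eq]
  fun_prop

theorem integrable_cayleyPoissonKernel (p : Measure ℝ) [IsFiniteMeasure p] {w : ℂ}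
    (hw : w ∈ upperHalf) : Integrable (cayleyPoissonKernel w) p :=
  .of_bound ((continuous_cayleyPoissonKernel hw).comp (.prodMk_right w.re)).aestronglyMeasurable _
    (.of_forall (norm_cayleyPoissonKernel_le hw))

variable {f : ℝ → ℝ}

theorem integrable_cayleyPoissonKernel_mul_prod (hf : Continuous f) (hfc : HasCompactSupport f)
    (p : Measure ℝ) [IsFiniteMeasure p] {y : ℝ} (hy : 0 < y) :
    Integrable (fun z : ℝ × ℝ => cayleyPoissonKernel ⟨z.1, y⟩ z.2 * f z.1) (volume.prod p) := by
  have hbound : Integrable fun x => ((1 + 2 * x ^ 2) * y⁻¹ + 2 * y) * ‖f x‖ :=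
    Continuous.integrable_of_hasCompactSupport (by fun_prop) hfc.norm.mul_left
  refine hbound.comp_fst p |>.mono' ?_ (.of_forall fun z => ?_)
  · exact ((continuous_cayleyPoissonKernel hy).mul (by fun_prop)).aestronglyMeasurable
  · rw [norm_mul]
    gcongr
    exact norm_cayleyPoissonKernel_le (w := ⟨z.1, y⟩) hy z.2

theorem exists_norm_integral_cayleyPoissonKernel_mul_le (hf : Continuous f)
    (hfc : HasCompactSupport f) :
    ∃ C, ∀ y ∈ Set.Ioc (0 : ℝ) 1, ∀ t, ‖∫ x, cayleyPoissonKernel ⟨x, y⟩ t * f x‖ ≤ C := by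
  let g : ℝ → ℝ := fun x => (1 + 2 * x ^ 2) * ‖f x‖
  have hg : Continuous g := by fun_prop
  have hgc : HasCompactSupport g := hfc.norm.mul_left
  obtain ⟨A, hA⟩ := hgc.exists_bound_of_continuous hg
  have hfi : Integrable fun x => ‖f x‖ := (hf.integrable_of_hasCompactSupport hfc).norm
  refine ⟨Real.pi * A + 2 * ∫ x, ‖f x‖, fun y ⟨hy, hy1⟩ t => ?_⟩
  have hPg : Integrable fun x => halfPlanePoisson y (x - t) • g x := by
    have hP := continuous_halfPlanePoisson hy
    exact Continuous.integrable_of_hasCompactSupport (by fun_prop)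
      (hgc.smul_left (f := fun x => halfPlanePoisson y (x - t)))
  calc ‖∫ x, cayleyPoissonKernel ⟨x, y⟩ t * f x‖
      ≤ ∫ x, (halfPlanePoisson y (x - t) • g x + 2 * y * ‖f x‖) := by
        refine norm_integral_le_of_norm_le (hPg.add (hfi.const_mul _)) (.of_forall fun x => ?_)
        have hw : (⟨x, y⟩ : ℂ) ∈ upperHalf := hy
        rw [norm_mul, Real.norm_of_nonneg (cayleyPoissonKernel_nonneg hw t)]
        refine (mul_le_mul_of_nonneg_right (cayleyPoissonKernel_le hw t)
          (norm_nonneg _)).trans_eq ?_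
        simp only [g, smul_eq_mul]
        ring
    _ = (∫ x, halfPlanePoisson y (x - t) • g x) + 2 * y * ∫ x, ‖f x‖ := by
        rw [integral_add hPg (hfi.const_mul _), integral_const_mul]
    _ ≤ Real.pi * A + 2 * ∫ x, ‖f x‖ := by
        gcongr
        · exact (le_abs_self _).trans (norm_integral_halfPlanePoisson_smul_le hA hy t)
        · linarith

theorem stieltjes_inversion_cayleyPoissonKernel (hf : Continuous f)
    (hfc : HasCompactSupport f) (p : Measure ℝ) [IsFiniteMeasure p] :
    Tendsto (fun y => ∫ x, (∫ t, cayleyPoissonKernel ⟨x, y⟩ t ∂p) * f x) (𝓝[>] 0)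
      (𝓝 (∫ t, (1 + t ^ 2) * (Real.pi * f t) ∂p)) := by
  obtain ⟨C, hC⟩ := exists_norm_integral_cayleyPoissonKernel_mul_le hf hfc
  obtain ⟨A, hA⟩ := hfc.exists_bound_of_continuous hf
  have hIoc : ∀ᶠ y : ℝ in 𝓝[>] 0, y ∈ Set.Ioc (0 : ℝ) 1 := Ioc_mem_nhdsGT one_pos
  have h : Tendsto (fun y => ∫ t, (∫ x, cayleyPoissonKernel ⟨x, y⟩ t * f x) ∂p) (𝓝[>] 0)
      (𝓝 (∫ t, (1 + t ^ 2) * (Real.pi * f t) ∂p)) := by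
    refine tendsto_integral_filter_of_dominated_convergence (fun _ => C) ?_ ?_
      (integrable_const C) (.of_forall fun t => ?_)
    · filter_upwards [hIoc] with y hy
      exact (integrable_cayleyPoissonKernel_mul_prod hf hfc p
        hy.1).swap.aestronglyMeasurable.integral_prod_right'
    · filter_upwards [hIoc] with y hy
      exact .of_forall (hC y hy)
    · simp only [cayleyPoissonKernel_eq, mul_assoc, integral_const_mul]
      exact (tendsto_integral_halfPlanePoisson_smul hf hA t).const_mul _
  refine h.congr' ?_
  filter_upwards [hIoc] with y hy
  rw [← integral_integral_swap (integrable_cayleyPoissonKernel_mul_prod hf hfc p hy.1)]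
  simp only [integral_mul_const]

theorem integral_one_add_sq_mul_eq_of_integral_cayleyPoissonKernel_eq (hf : Continuous f)
    (hfc : HasCompactSupport f)
    {p q : Measure ℝ} [IsFiniteMeasure p] [IsFiniteMeasure q] (d : ℝ)
    (h : ∀ w ∈ upperHalf, ∫ t, cayleyPoissonKernel w t ∂p =
      (∫ t, cayleyPoissonKernel w t ∂q) + w.im * d) :
    ∫ t, (1 + t ^ 2) * (Real.pi * f t) ∂p = ∫ t, (1 + t ^ 2) * (Real.pi * f t) ∂q := by
  have hp := stieltjes_inversion_cayleyPoissonKernel hf hfc p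
  have hq := stieltjes_inversion_cayleyPoissonKernel hf hfc q
  have hd : Tendsto (fun y : ℝ => y * (d * ∫ x, f x)) (𝓝[>] 0) (𝓝 0) := by
    have hcont : Continuous fun y : ℝ => y * (d * ∫ x, f x) := by fun_prop
    simpa only [zero_mul] using tendsto_nhdsWithin_of_tendsto_nhds (hcont.tendsto 0)
  have hqd := hq.add hd
  rw [add_zero] at hqd
  refine tendsto_nhds_unique hp (hqd.congr' ?_)
  filter_upwards [self_mem_nhdsWithin] with y hy
  have hfi : Integrable f := hf.integrable_of_hasCompactSupport hfc
  have hqi : Integrable fun x => (∫ t, cayleyPoissonKernel ⟨x, y⟩ t ∂q) * f x := by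
    simpa only [integral_mul_const] using
      (integrable_cayleyPoissonKernel_mul_prod hf hfc q hy).integral_prod_left
  calc (∫ x, (∫ t, cayleyPoissonKernel ⟨x, y⟩ t ∂q) * f x) + y * (d * ∫ x, f x)
      = ∫ x, ((∫ t, cayleyPoissonKernel ⟨x, y⟩ t ∂q) * f x + y * (d * f x)) := by
        rw [integral_add hqi ((hfi.const_mul d).const_mul y), integral_const_mul,
          integral_const_mul]
    _ = ∫ x, (∫ t, cayleyPoissonKernel ⟨x, y⟩ t ∂p) * f x := by
        congr 1 with x
        rw [h ⟨x, y⟩ hy, add_mul, mul_assoc]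

theorem measure_eq_of_integral_cayleyPoissonKernel_eq {p q : Measure ℝ}
    [IsFiniteMeasure p] [IsFiniteMeasure q] (d : ℝ)
    (h : ∀ w ∈ upperHalf, ∫ t, cayleyPoissonKernel w t ∂p =
      (∫ t, cayleyPoissonKernel w t ∂q) + w.im * d) : p = q := by
  refine Measure.ext_of_integral_eq_on_compactlySupported fun g => ?_
  let f : ℝ → ℝ := fun t => (Real.pi⁻¹ * (1 + t ^ 2)⁻¹) * g t
  have hf : Continuous f :=
    (continuous_const.mul (.inv₀ (by fun_prop) fun t => by positivity)).mul g.continuous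
  have hfg (t : ℝ) : (1 + t ^ 2) * (Real.pi * f t) = g t := by
    simp only [f]
    field_simp
  simpa only [hfg] using
    integral_one_add_sq_mul_eq_of_integral_cayleyPoissonKernel_eq hf g.hasCompactSupport.mul_left
      d h

end CayleyPoissonKernel

section Uniqueness

theorem signedMeasure_eq_zero_of_integral_cayleyPoissonKernel_eq {s : SignedMeasure ℝ} (d : ℝ)
    (h : ∀ w ∈ upperHalf, ∫ᵛ t, cayleyPoissonKernel w t ∂•s = w.im * d) : s = 0 := by
  have hflip : (ContinuousLinearMap.lsmul ℝ ℝ : ℝ →L[ℝ] ℝ →L[ℝ] ℝ) =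
      (ContinuousLinearMap.lsmul ℝ ℝ).flip := by
    ext
    simp
  have hparts : s.toJordanDecomposition.posPart = s.toJordanDecomposition.negPart := by
    refine measure_eq_of_integral_cayleyPoissonKernel_eq d fun w hw => ?_
    rw [← h w hw, hflip, signedMeasure_integral_eq_sub s (integrable_cayleyPoissonKernel _ hw)
      (integrable_cayleyPoissonKernel _ hw), add_sub_cancel]
  rw [← s.toSignedMeasure_toJordanDecomposition, JordanDecomposition.toSignedMeasure]
  simp only [hparts, sub_self]

variable {F : Type*} [NormedAddCommGroup F] [NormedSpace ℝ F]

theorem vectorMeasure_eq_zero_of_integral_cayleyPoissonKernel_eq [CompleteSpace F]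
    {μ : VectorMeasure ℝ F} [IsFiniteMeasure μ.variation] (a : F)
    (h : ∀ w ∈ upperHalf, ∫ᵛ t, cayleyPoissonKernel w t ∂•μ = w.im • a) : μ = 0 := by
  ext E _
  refine SeparatingDual.eq_zero_of_forall_dual_eq_zero (R := ℝ) fun T => ?_
  have hT : μ.mapRange (T : F →+ ℝ) T.continuous = 0 := by
    refine signedMeasure_eq_zero_of_integral_cayleyPoissonKernel_eq (T a) fun w hw => ?_
    rw [integral_mapRange μ T (integrable_cayleyPoissonKernel _ hw), h w hw, map_smul, smul_eq_mul]
  exact congrArg (fun ν : SignedMeasure ℝ => ν E) hT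

theorem vectorMeasure_eq_of_integral_cayleyPoissonKernel_eq [FiniteDimensional ℝ F]
    {μ ν : VectorMeasure ℝ F} (a b : F)
    (h : ∀ w ∈ upperHalf, w.im • a + ∫ᵛ t, cayleyPoissonKernel w t ∂•μ =
      w.im • b + ∫ᵛ t, cayleyPoissonKernel w t ∂•ν) : μ = ν := by
  have := FiniteDimensional.complete ℝ F
  have hfin (ρ : VectorMeasure ℝ F) := isFiniteMeasure_variation ρ
  refine sub_eq_zero.1 (vectorMeasure_eq_zero_of_integral_cayleyPoissonKernel_eq (b - a)
    fun w hw => ?_)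
  rw [VectorMeasure.integral_sub_vectorMeasure (integrable_cayleyPoissonKernel _ hw)
    (integrable_cayleyPoissonKernel _ hw), smul_sub, sub_eq_sub_iff_add_eq_add, add_comm, h w hw]

variable {n : ℕ} {C : ℂ → Matrix (Fin n) (Fin n) ℂ}
  {μ ν : VectorMeasure ℝ (Matrix (Fin n) (Fin n) ℂ)}

theorem IsClarkMeasure.unique (hμ : IsClarkMeasure C μ) (hν : IsClarkMeasure C ν) : μ = ν := by
  obtain ⟨-, a, -, ha⟩ := hμ
  obtain ⟨-, b, -, hb⟩ := hν
  ext E _ j k : 3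
  have hentry : measureEntry μ j k = measureEntry ν j k :=
    vectorMeasure_eq_of_integral_cayleyPoissonKernel_eq (a j k) (b j k) fun w hw => by
      simpa only [Complex.real_smul] using (ha w hw j k).symm.trans (hb w hw j k)
  exact congrArg (fun c : ComplexMeasure ℝ => c E) hentry

theorem IsClarkMeasure.clarkMeasure_eq (hμ : IsClarkMeasure C μ) : clarkMeasure C = μ := by
  have hex : ∃ μ, IsClarkMeasure C μ := ⟨μ, hμ⟩
  rw [clarkMeasure, dif_pos hex]
  exact hex.choose_spec.unique hμ

theorem clarkMeasure_eq_zero (hC : ¬ ∃ μ, IsClarkMeasure C μ) : clarkMeasure C = 0 :=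
  dif_neg hC

end Uniqueness

section RadonNikodym

variable {X : Type*} {mX : MeasurableSpace X} (m : Measure X) [SigmaFinite m]

theorem complexMeasure_re_smul (z : ℂ) (c : ComplexMeasure X) :
    ComplexMeasure.re (z • c) = z.re • ComplexMeasure.re c - z.im • ComplexMeasure.im c := by
  ext s _
  exact Complex.mul_re z (c s)

theorem complexMeasure_im_smul (z : ℂ) (c : ComplexMeasure X) :
    ComplexMeasure.im (z • c) = z.re • ComplexMeasure.im c + z.im • ComplexMeasure.re c := by
  ext s _
  exact Complex.mul_im z (c s)

theorem complexMeasure_rnDeriv_add (c d : ComplexMeasure X) :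
    (c + d).rnDeriv m =ᵐ[m] c.rnDeriv m + d.rnDeriv m := by
  have hre := SignedMeasure.rnDeriv_add (ComplexMeasure.re c) (ComplexMeasure.re d) m
  have him := SignedMeasure.rnDeriv_add (ComplexMeasure.im c) (ComplexMeasure.im d) m
  rw [← map_add] at hre him
  filter_upwards [hre, him] with x hre_x him_x using Complex.ext hre_x him_x

theorem complexMeasure_rnDeriv_smul (z : ℂ) (c : ComplexMeasure X) :
    (z • c).rnDeriv m =ᵐ[m] z • c.rnDeriv m := by
  let a := ComplexMeasure.re c
  let b := ComplexMeasure.im c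
  have hre : (ComplexMeasure.re (z • c)).rnDeriv m =ᵐ[m]
      z.re • a.rnDeriv m - z.im • b.rnDeriv m := by
    rw [complexMeasure_re_smul]
    exact (SignedMeasure.rnDeriv_sub _ _ m).trans
      ((SignedMeasure.rnDeriv_smul a m z.re).sub (SignedMeasure.rnDeriv_smul b m z.im))
  have him : (ComplexMeasure.im (z • c)).rnDeriv m =ᵐ[m]
      z.re • b.rnDeriv m + z.im • a.rnDeriv m := by
    rw [complexMeasure_im_smul]
    exact (SignedMeasure.rnDeriv_add _ _ m).trans
      ((SignedMeasure.rnDeriv_smul b m z.re).add (SignedMeasure.rnDeriv_smul a m z.im))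
  filter_upwards [hre, him] with x hre_x him_x
  exact Complex.ext (hre_x.trans (Complex.mul_re z (c.rnDeriv m x)).symm)
    (him_x.trans (Complex.mul_im z (c.rnDeriv m x)).symm)

theorem complexMeasure_rnDeriv_sum {ι : Type*} (t : Finset ι) (c : ι → ComplexMeasure X) :
    (∑ i ∈ t, c i).rnDeriv m =ᵐ[m] ∑ i ∈ t, (c i).rnDeriv m := by
  refine Finset.sum_hom_rel (r := fun d g => ComplexMeasure.rnDeriv d m =ᵐ[m] g) ?_
    fun i d g hdg => (complexMeasure_rnDeriv_add m (c i) d).trans ((EventuallyEq.refl _ _).add hdg)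
  have hzero := complexMeasure_rnDeriv_smul m 0 (0 : ComplexMeasure X)
  have h0 : (0 : ℂ) • (0 : ComplexMeasure X) = 0 := by
    ext1 s _
    exact zero_mul (0 : ℂ)
  rwa [h0, zero_smul] at hzero

end RadonNikodym

section Conjugation

theorem mul_mul_conjTranspose_apply {ι κ S : Type*} [Fintype ι] [CommSemiring S] [StarRing S]
    (R : Matrix κ ι S) (A : Matrix ι ι S) (j k : κ) :
    (R * A * Rᴴ) j k = ∑ p : ι × ι, R j p.1 * star (R k p.2) * A p.1 p.2 := by
  rw [Fintype.sum_prod_type_right]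
  simp only [Matrix.mul_apply, Matrix.conjTranspose_apply, Finset.sum_mul, mul_right_comm]

theorem integral_sum_smul_complexMeasure {X : Type*} {mX : MeasurableSpace X} {ι : Type*}
    (t : Finset ι) (z : ι → ℂ) (c : ι → ComplexMeasure X) {f : X → ℝ}
    (hf : ∀ i ∈ t, (c i).Integrable f) :
    ∫ᵛ x, f x ∂•(∑ i ∈ t, z i • c i) = ∑ i ∈ t, z i * ∫ᵛ x, f x ∂•(c i) := by
  have hsmul (i : ι) : z i • c i = (c i).mapRange (ContinuousLinearMap.mul ℝ ℂ (z i) : ℂ →+ ℂ)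
      (ContinuousLinearMap.mul ℝ ℂ (z i)).continuous := rfl
  have hint (i : ι) (hi : i ∈ t) : (z i • c i).Integrable f := by
    rw [VectorMeasure.Integrable, VectorMeasure.variation_smul]
    exact (hf i hi).smul_measure enorm_ne_top
  rw [VectorMeasure.integral_finsetSum_vectorMeasure hint]
  refine Finset.sum_congr rfl fun i hi => ?_
  rw [hsmul, integral_mapRange _ _ (hf i hi), ContinuousLinearMap.mul_apply']

variable {m n : ℕ}

/-- The matrix-valued measure `R μ R*`. -/
noncomputable def conjMeasure (R : Matrix (Fin m) (Fin n) ℂ)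
    (μ : VectorMeasure ℝ (Matrix (Fin n) (Fin n) ℂ)) :
    VectorMeasure ℝ (Matrix (Fin m) (Fin m) ℂ) :=
  μ.mapRange
    { toFun := fun A => R * A * Rᴴ
      map_zero' := by rw [Matrix.mul_zero, Matrix.zero_mul]
      map_add' := fun A B => by rw [Matrix.mul_add, Matrix.add_mul] }
    ((continuous_const.matrix_mul continuous_id).matrix_mul continuous_const)

theorem measureEntry_conjMeasure (R : Matrix (Fin m) (Fin n) ℂ)
    (μ : VectorMeasure ℝ (Matrix (Fin n) (Fin n) ℂ)) (j k : Fin m) :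
    measureEntry (conjMeasure R μ) j k =
      ∑ p : Fin n × Fin n, (R j p.1 * star (R k p.2)) • measureEntry μ p.1 p.2 := by
  ext1 s _
  rw [← FunLike.coeAddMonoidHom_apply (∑ p : Fin n × Fin n, _), map_sum, Finset.sum_apply]
  exact mul_mul_conjTranspose_apply R (μ s) j k

theorem conjMeasure_zero (R : Matrix (Fin m) (Fin n) ℂ) : conjMeasure R 0 = 0 :=
  VectorMeasure.mapRange_zero _

theorem lebesgueWeight_conjMeasure (R : Matrix (Fin m) (Fin n) ℂ)
    (μ : VectorMeasure ℝ (Matrix (Fin n) (Fin n) ℂ)) :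
    ∀ᵐ s : ℝ, lebesgueWeight (conjMeasure R μ) s = R * lebesgueWeight μ s * Rᴴ := by
  simp only [← Matrix.ext_iff]
  refine ae_all_iff.2 fun j => ae_all_iff.2 fun k => ?_
  let c (p : Fin n × Fin n) : ComplexMeasure ℝ :=
    (R j p.1 * star (R k p.2)) • measureEntry μ p.1 p.2
  have hsmul : ∀ᵐ s : ℝ, ∀ p, (c p).rnDeriv volume s =
      R j p.1 * star (R k p.2) * (measureEntry μ p.1 p.2).rnDeriv volume s :=
    ae_all_iff.2 fun p => complexMeasure_rnDeriv_smul volume _ _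
  filter_upwards [complexMeasure_rnDeriv_sum volume Finset.univ c, hsmul] with s hsum_s hsmul_s
  calc lebesgueWeight (conjMeasure R μ) s j k
      = (∑ p, c p).rnDeriv volume s := by
        rw [lebesgueWeight, Matrix.of_apply, measureEntry_conjMeasure]
    _ = ∑ p, (c p).rnDeriv volume s := by rw [hsum_s, Finset.sum_apply]
    _ = (R * lebesgueWeight μ s * Rᴴ) j k := by
        rw [mul_mul_conjTranspose_apply]
        exact Finset.sum_congr rfl fun p _ => hsmul_s p

theorem hermitianPart_conj (R : Matrix (Fin m) (Fin n) ℂ) (A : Matrix (Fin n) (Fin n) ℂ) :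
    hermitianPart (R * A * Rᴴ) = R * hermitianPart A * Rᴴ := by
  simp only [hermitianPart, Matrix.conjTranspose_mul, Matrix.conjTranspose_conjTranspose,
    Matrix.mul_smul, Matrix.smul_mul, Matrix.mul_add, Matrix.add_mul, Matrix.mul_assoc]

variable {C D : ℂ → Matrix (Fin n) (Fin n) ℂ} {R : Matrix (Fin n) (Fin n) ℂ}

theorem herglotz_conj (hR : R ∈ Matrix.unitaryGroup (Fin n) ℂ) {w : ℂ}
    (h : D w = R * C w * Rᴴ) : herglotz D w = R * herglotz C w * Rᴴ := by
  have hRR : R * Rᴴ = 1 := Matrix.mem_unitaryGroup_iff.1 hR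
  have hRR' : Rᴴ * R = 1 := Matrix.mem_unitaryGroup_iff'.1 hR
  have hsub : 1 - D w = R * (1 - C w) * Rᴴ := by rw [h, mul_sub, sub_mul, mul_one, hRR]
  have hadd : 1 + D w = R * (1 + C w) * Rᴴ := by rw [h, mul_add, add_mul, mul_one, hRR]
  have hinv : (R * (1 - C w) * Rᴴ)⁻¹ = R * (1 - C w)⁻¹ * Rᴴ := by
    rw [Matrix.mul_inv_rev, Matrix.mul_inv_rev, Matrix.inv_eq_right_inv hRR,
      Matrix.inv_eq_right_inv hRR', mul_assoc]
  calc herglotz D w = R * (1 - C w)⁻¹ * (Rᴴ * R) * (1 + C w) * Rᴴ := by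
        rw [herglotz, hsub, hadd, hinv]
        simp only [mul_assoc]
    _ = R * herglotz C w * Rᴴ := by
        rw [hRR', mul_one, herglotz, ← mul_assoc R]

theorem IsClarkMeasure.conj (hR : R ∈ Matrix.unitaryGroup (Fin n) ℂ)
    (h : ∀ w ∈ upperHalf, D w = R * C w * Rᴴ)
    {μ : VectorMeasure ℝ (Matrix (Fin n) (Fin n) ℂ)} (hμ : IsClarkMeasure C μ) :
    IsClarkMeasure D (conjMeasure R μ) := by
  obtain ⟨hpos, c, hc, hrep⟩ := hμ
  refine ⟨fun E hE => (hpos E hE).mul_mul_conjTranspose_same R, R * c * Rᴴ,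
    hc.mul_mul_conjTranspose_same R, fun w hw j k => ?_⟩
  have hfin (ρ : ComplexMeasure ℝ) := isFiniteMeasure_variation ρ
  rw [herglotz_conj hR (h w hw), hermitianPart_conj, measureEntry_conjMeasure,
    integral_sum_smul_complexMeasure _ _ _ fun _ _ => integrable_cayleyPoissonKernel _ hw,
    mul_mul_conjTranspose_apply, mul_mul_conjTranspose_apply, Finset.mul_sum,
    ← Finset.sum_add_distrib]
  refine Finset.sum_congr rfl fun p _ => ?_
  rw [hrep w hw]
  ring

theorem clarkMeasure_conj (hR : R ∈ Matrix.unitaryGroup (Fin n) ℂ)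
    (h : ∀ w ∈ upperHalf, D w = R * C w * Rᴴ) :
    clarkMeasure D = conjMeasure R (clarkMeasure C) := by
  by_cases hC : ∃ μ, IsClarkMeasure C μ
  · obtain ⟨μ, hμ⟩ := hC
    rw [hμ.clarkMeasure_eq, (hμ.conj hR h).clarkMeasure_eq]
  · -- `clarkMeasure` is `0` when there is no Clark measure, so a Clark measure of `D` has to be
    -- carried back to one of `C`.
    have hCD : ∀ w ∈ upperHalf, C w = Rᴴ * D w * Rᴴᴴ := fun w hw => by
      have hRR : Rᴴ * R = 1 := Matrix.mem_unitaryGroup_iff'.1 hR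
      rw [h w hw, Matrix.conjTranspose_conjTranspose, mul_assoc, mul_assoc, mul_assoc, hRR,
        mul_one, ← mul_assoc, hRR, one_mul]
    have hD : ¬ ∃ μ, IsClarkMeasure D μ := fun ⟨μ, hμ⟩ =>
      hC ⟨conjMeasure Rᴴ μ, hμ.conj (Unitary.star_mem hR) hCD⟩
    rw [clarkMeasure_eq_zero hC, clarkMeasure_eq_zero hD, conjMeasure_zero]

end Conjugation

theorem mainTheorem5_general {n : ℕ} {C D : ℂ → Matrix (Fin n) (Fin n) ℂ}
    {R : Matrix (Fin n) (Fin n) ℂ} (hR : R ∈ Matrix.unitaryGroup (Fin n) ℂ)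
    (hD : ∀ w ∈ upperHalf, D w = R * C w * Rᴴ) (hinv : ∀ w ∈ upperHalf, IsUnit (1 - D w)) :
    ∀ᵐ s : ℝ, lebesgueWeight (clarkMeasure D) s =
      R * lebesgueWeight (clarkMeasure C) s * Rᴴ :=
  clarkMeasure_conj hR hD ▸ lebesgueWeight_conjMeasure R _

theorem mainTheorem5 (n : ℕ) (B₁ B₂ : ℂ → Matrix (Fin n) (Fin n) ℂ)
    (hB₁ : B₁ ∈ schurClass n upperHalf) (hB₂ : B₂ ∈ schurClass n upperHalf)
    (R Q α : Matrix (Fin n) (Fin n) ℂ)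
    (hR : R ∈ Matrix.unitaryGroup (Fin n) ℂ) (hQ : Q ∈ Matrix.unitaryGroup (Fin n) ℂ)
    (hα : α ∈ Matrix.unitaryGroup (Fin n) ℂ)
    (hB : ∀ w ∈ upperHalf, B₁ w = R * B₂ w * Q)
    (hinv : ∀ w ∈ upperHalf, IsUnit (1 - B₁ w * αᴴ)) :
    ∀ᵐ s : ℝ, lebesgueWeight (clarkMeasure fun w => B₁ w * αᴴ) s =
      R * lebesgueWeight (clarkMeasure fun w => B₂ w * (Q * αᴴ * R)) s * Rᴴ :=
  mainTheorem5_general hR (fun w hw => by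
    have hRR : R * Rᴴ = 1 := Matrix.mem_unitaryGroup_iff.1 hR
    simp only [hB w hw, mul_assoc, hRR, mul_one]) hinv
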